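/- Let $R$ be a finite commutative ring with $1$. A linear map between finite-rank free $R$-modules is called splittable if its cokernel is free. Let $\mathtt{V}(R)$ be the category whose objects are the finite-rank free $R$-modules and whose morphisms are the finite composites of splittable linear maps (if $R$ is a field, these are just the splittable maps, i.e. all linear maps; for general $R$ the composite of two splittable maps need not be splittable, and $\mathtt{V}(R)$ is the category of free modules generated by the splittable maps). For a ring $\mathbf{k}$ and a category $\mathtt{C}$, a $\mathtt{C}$-module over $\mathbf{k}$ is a functor $M\colon \mathtt{C}\to \mathrm{Mod}_{\mathbf{k}}$ to (left) $\mathbf{k}$-modules; a $\mathtt{C}$-submodule of $M$ is a family of submodules $N(X)\subseteq M(X)$, one for each object $X$, preserved by all the maps $M(f)$; and $M$ is finitely generated if there are finitely many objects $X_1,\dots,X_n$ and elements $x_i\in M(X_i)$ such that the smallest $\mathtt{C}$-submodule of $M$ containing all the $x_i$ is $M$ itself. Theorem B (Artinian conjecture). The category of $\mathtt{V}(R)$-modules is Noetherian: for every (left) Noetherian unital ring $\mathbf{k}$, commutative or not, every $\mathtt{V}(R)$-submodule of a finitely generated $\mathtt{V}(R)$-module over $\mathbf{k}$ is finitely generated.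 -/

import Mathlib

open CategoryTheory

universe u w w' v₁ u₁

/-! ### Modules over a category -/

namespace CatMod

variable {k : Type w} [Ring k] {C : Type u₁} [Category.{v₁} C]

/-- A `C`-submodule of a `C`-module `M : C ⥤ ModuleCat k`: a `k`-submodule of each `M X`,
preserved by all the maps `M f`. -/
structure Sub (M : C ⥤ ModuleCat.{w'} k) where
  /-- The submodule of `M X`. -/
  obj (X : C) : Submodule k (M.obj X)
  /-- The structure maps of `M` preserve these submodules. -/
  map {X Y : C} (f : X ⟶ Y) : obj X ≤ (obj Y).comap (M.map f).hom

/-- A `C`-submodule, regarded as a `C`-module. -/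
def Sub.toFunctor {M : C ⥤ ModuleCat.{w'} k} (N : Sub M) : C ⥤ ModuleCat.{w'} k where
  obj X := ModuleCat.of k (N.obj X)
  map f := ModuleCat.ofHom ((M.map f).hom.restrict (N.map f))
  map_id X := by
    ext x
    exact congrArg (fun g => g.hom x.1) (M.map_id X)
  map_comp f g := by
    ext x
    exact congrArg (fun h => h.hom x.1) (M.map_comp f g)

/-- A `C`-module is finitely generated if there are finitely many elements `x i ∈ M (X i)` such
that the only `C`-submodule of `M` containing all of them is `M` itself. -/
def FinitelyGenerated (M : C ⥤ ModuleCat.{w'} k) : Prop :=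
  ∃ (n : ℕ) (X : Fin n → C) (x : ∀ i, M.obj (X i)),
    ∀ N : Sub M, (∀ i, x i ∈ N.obj (X i)) → ∀ Y, N.obj Y = ⊤

variable (k C) in
/-- The category of `C`-modules over `k` is Noetherian: all submodules of finitely generated
`C`-modules over `k` are finitely generated. -/
def NoetherianOver : Prop :=
  ∀ M : C ⥤ ModuleCat.{w'} k, FinitelyGenerated M →
    ∀ N : Sub M, FinitelyGenerated N.toFunctor

end CatMod

/-- The category of `C`-modules is Noetherian: the category of `C`-modules over `k` is Noetherian
for every (left) Noetherian unital ring `k`, commutative or not. -/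
def CatMod.Noetherian (C : Type u₁) [Category.{v₁} C] : Prop :=
  ∀ (k : Type w) [Ring k] [IsNoetherianRing k], CatMod.NoetherianOver.{w, w'} k C

/-! ### The category of free modules and splittable maps -/

/-- Finite-rank free `R`-modules. -/
def finiteFree (R : Type u) [CommRing R] : ObjectProperty (ModuleCat.{u} R) :=
  fun V => Module.Free R V ∧ Module.Finite R V

/-- A linear map between finite-rank free `R`-modules is splittable if its cokernel is free. -/
def splittable (R : Type u) [CommRing R] : MorphismProperty (finiteFree R).FullSubcategory :=
  fun V W f => Module.Free R (W.obj ⧸ LinearMap.range (f.hom.hom : V.obj →ₗ[R] W.obj))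

/-- The category of finite-rank free `R`-modules and splittable linear maps, i.e. the subcategory
of the category of finite-rank free `R`-modules that has all its objects and is generated by the
splittable maps. If `R` is a field then every linear map is splittable. In general a composite
of two splittable maps need not be splittable (multiplication by `2` on `ZMod 4` is the composite
of `x ↦ (x, 0)` and `(x, y) ↦ 2 * x + y`), so that the morphisms are the finite composites of
splittable maps. -/
abbrev VCat (R : Type u) [CommRing R] : Type (u + 1) :=
  WideSubcategory (splittable R).multiplicativeClosure

/-! Every linear map lies in `VCat R`, since it factors through its graph. So a finitely generated
module M is generated by finitely many elements of a single M(R^d), and M(R^n) is spanned by their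
images under n × d matrices, that is, by coloured words of length n in the finite alphabet R^d.
Repeating coordinates along s pulls words back along s, and the ordered surjections s already
suffice for finite generation: they preserve the lexicographic order strictly
(`IsOrderedSurjection.lex_lt`) and well-quasi-order the words by Higman's lemma
(`wellQuasiOrdered_words`). The rest is a Gröbner basis argument (`exists_finset_generating`):
leading ideals grow along the quasi-order, so finitely many of them determine all, and a subfamily
with the same leading ideals is everything. -/

/-! ### Gröbner bases for families of free modules -/

section Groebner

variable {k : Type*} [Ring k]

/-- The left ideal of the coefficients at `t` of those elements of `K` all of whose monomials
are at most `t`. -/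
noncomputable def leadingIdeal {T : Type*} [LinearOrder T] (K : Submodule k (T →₀ k)) (t : T) : Ideal k :=
  (K ⊓ Finsupp.supported k k (Set.Iic t)).map (Finsupp.lapply t)

theorem mem_leadingIdeal {T : Type*} [LinearOrder T] {K : Submodule k (T →₀ k)} {t : T} {c : k} :
    c ∈ leadingIdeal K t ↔ ∃ x ∈ K, x ∈ Finsupp.supported k k (Set.Iic t) ∧ x t = c := by
  simp [leadingIdeal, and_assoc]

/-- A strictly monotone map of monomials carries leading terms to leading terms with the same
coefficient. -/
theorem leadingIdeal_le_of_strictMono {T T' : Type*} [LinearOrder T] [LinearOrder T']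
    {K : Submodule k (T →₀ k)} {K' : Submodule k (T' →₀ k)} {f : T → T'} (hf : StrictMono f)
    (h : ∀ x ∈ K, x.mapDomain f ∈ K') (t : T) : leadingIdeal K t ≤ leadingIdeal K' (f t) := by
  intro c hc
  obtain ⟨x, hx, hxt, rfl⟩ := mem_leadingIdeal.1 hc
  refine mem_leadingIdeal.2 ⟨x.mapDomain f, h x hx, ?_, Finsupp.mapDomain_apply hf.injective x t⟩
  classical
  rw [Finsupp.mem_supported] at hxt ⊢
  intro u hu
  obtain ⟨v, hv, rfl⟩ := Finset.mem_image.1 (Finsupp.mapDomain_support hu)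
  exact hf.monotone (hxt hv)

/-- Division algorithm: subtracting an element of `K'` with the same leading term lowers the leading
monomial, which terminates by well-foundedness. -/
theorem le_of_leadingIdeal_le {T : Type*} [LinearOrder T] [WellFoundedLT T]
    {K K' : Submodule k (T →₀ k)} (hle : K' ≤ K)
    (h : ∀ t, leadingIdeal K t ≤ leadingIdeal K' t) : K ≤ K' := by
  have key : ∀ t, ∀ x ∈ K, x ∈ Finsupp.supported k k (Set.Iic t) → x ∈ K' := by
    intro t
    induction t using WellFoundedLT.induction with
    | ind t ih =>
      intro x hx hxt
      obtain ⟨y, hy, hyt, hxy⟩ := mem_leadingIdeal.1 (h t (mem_leadingIdeal.2 ⟨x, hx, hxt, rfl⟩))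
      suffices hz : x - y ∈ K' by simpa using K'.add_mem hz hy
      by_cases h0 : x - y = 0
      · simp [h0]
      have hne : (x - y).support.Nonempty := Finsupp.support_nonempty_iff.2 h0
      have hmem := (x - y).support.max'_mem hne
      refine ih ((x - y).support.max' hne) (lt_of_le_of_ne ?_ ?_) _ (K.sub_mem hx (hle hy)) ?_
      · exact (Finsupp.mem_supported k _).1 (Submodule.sub_mem _ hxt hyt) hmem
      · intro heq
        rw [heq, Finsupp.mem_support_iff] at hmem
        simp [hxy] at hmem
      · exact (Finsupp.mem_supported k _).2 fun u hu => Finset.le_max' _ _ hu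
  intro x hx
  by_cases h0 : x = 0
  · simp [h0]
  · exact key (x.support.max' (Finsupp.support_nonempty_iff.2 h0)) x hx
      ((Finsupp.mem_supported k _).2 fun u hu => Finset.le_max' _ _ hu)

/-- A monotone map from a well-quasi-order to a partial order with the ascending chain condition
is determined by finitely many of its values. -/
theorem WellQuasiOrdered.exists_finset_forall_exists_eq {α β : Type*} {r : α → α → Prop}
    [IsPreorder α r] (hr : WellQuasiOrdered r) [PartialOrder β] [WellFoundedGT β] (I : α → β)
    (hI : ∀ a b, r a b → I a ≤ I b) : ∃ F : Finset α, ∀ a, ∃ b ∈ F, r b a ∧ I b = I a := by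
  by_contra! hF
  obtain ⟨f, -, hf⟩ := exists_seq_of_forall_finset_exists (fun _ : α => True)
    (fun a b => r a b → I a ≠ I b) (fun s _ => (hF s).imp fun a ha => ⟨trivial, ha⟩)
  obtain ⟨g, hg⟩ := hr.exists_monotone_subseq f
  obtain ⟨n, hn⟩ := WellFoundedGT.monotone_chain_condition
    (⟨fun i => I (f (g i)), fun i j hij => hI _ _ (hg i j hij)⟩ : ℕ →o β)
  exact hf _ _ (g.strictMono n.lt_succ_self) (hg _ _ n.le_succ) (hn _ n.le_succ)

/-- Let `Op` be a class of strictly monotone maps between the well-ordered sets `T i`, such that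
the order on all monomials defined by these maps is a well-quasi-order. Then a family of
submodules of the free modules on the `T i` that is stable under `Op` is finitely generated. -/
theorem exists_finset_generating [IsNoetherianRing k] {ι : Type*} (T : ι → Type*)
    [∀ i, LinearOrder (T i)] [∀ i, WellFoundedLT (T i)] (Op : ∀ i j, (T i → T j) → Prop)
    (strictMono : ∀ i j f, Op i j f → StrictMono f)
    [IsPreorder (Σ i, T i) fun a b => ∃ f, Op a.1 b.1 f ∧ f a.2 = b.2]
    (hwqo : WellQuasiOrdered fun a b : Σ i, T i => ∃ f, Op a.1 b.1 f ∧ f a.2 = b.2)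
    (K : ∀ i, Submodule k (T i →₀ k))
    (hK : ∀ i j f, Op i j f → ∀ x ∈ K i, x.mapDomain f ∈ K j) :
    ∃ S : Finset (Σ i, K i), ∀ K' : ∀ i, Submodule k (T i →₀ k),
      (∀ i j f, Op i j f → ∀ x ∈ K' i, x.mapDomain f ∈ K' j) →
      (∀ s ∈ S, (s.2 : T s.1 →₀ k) ∈ K' s.1) → ∀ i, K i ≤ K' i := by
  classical
  obtain ⟨F, hF⟩ := hwqo.exists_finset_forall_exists_eq
    (fun a : Σ i, T i => leadingIdeal (K a.1) a.2) (by
      rintro ⟨i, a⟩ ⟨j, b⟩ ⟨f, hf, hfa⟩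
      dsimp only at f hf hfa ⊢
      subst hfa
      exact leadingIdeal_le_of_strictMono (strictMono _ _ f hf) (hK _ _ f hf) a)
  -- Lift finitely many generators of each leading ideal to elements of `K`.
  have hgen : ∀ a : Σ i, T i, ∃ s : Finset (K a.1), ∀ L : Submodule k (T a.1 →₀ k),
      (∀ x ∈ s, (x : T a.1 →₀ k) ∈ L) → leadingIdeal (K a.1) a.2 ≤ leadingIdeal L a.2 := by
    intro a
    obtain ⟨c, hc⟩ := IsNoetherian.noetherian (leadingIdeal (K a.1) a.2)
    have hc' : ∀ y ∈ c, ∃ x ∈ K a.1, x ∈ Finsupp.supported k k (Set.Iic a.2) ∧ x a.2 = y :=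
      fun y hy => mem_leadingIdeal.1 (hc ▸ Submodule.subset_span hy)
    choose x hx hxa hxy using hc'
    let z : {y // y ∈ c} → K a.1 := fun y => ⟨x y.1 y.2, hx y.1 y.2⟩
    refine ⟨c.attach.image z, fun L hL => ?_⟩
    rw [← hc, Submodule.span_le]
    intro y hy
    exact mem_leadingIdeal.2 ⟨x y hy, hL (z ⟨y, hy⟩)
      (Finset.mem_image_of_mem z (Finset.mem_attach _ _)), hxa y hy, hxy y hy⟩
  choose s hs using hgen
  refine ⟨F.biUnion fun a => (s a).image fun y => (⟨a.1, y⟩ : Σ i, K i), fun K' hK' hSK' i => ?_⟩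
  -- Division must stay inside `K`, hence the intersection.
  refine (le_of_leadingIdeal_le (K' := K' i ⊓ K i) inf_le_right fun t => ?_).trans inf_le_left
  obtain ⟨⟨j, b⟩, hbF, ⟨f, hf, hfb⟩, hb⟩ := hF ⟨i, t⟩
  dsimp only at f hf hfb hb
  subst hfb
  rw [← hb]
  refine (hs ⟨j, b⟩ (K' j ⊓ K j) fun x hx => ⟨?_, x.2⟩).trans
    (leadingIdeal_le_of_strictMono (K := K' j ⊓ K j) (strictMono _ _ f hf)
      (fun x hx => Submodule.mem_inf.2 ⟨hK' _ _ f hf x hx.1, hK _ _ f hf x hx.2⟩) b)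
  exact hSK' ⟨j, x⟩ (Finset.mem_biUnion.2 ⟨_, hbF, Finset.mem_image_of_mem _ hx⟩)

end Groebner

/-! ### Words and ordered surjections -/

section Words

/-- A surjection between finite ordinals is ordered if the minima of its fibres are in increasing
order. -/
def IsOrderedSurjection {m n : ℕ} (s : Fin m → Fin n) : Prop :=
  ∃ g : Fin n → Fin m, StrictMono g ∧ (∀ j, s (g j) = j) ∧ ∀ p, g (s p) ≤ p

theorem IsOrderedSurjection.id (n : ℕ) : IsOrderedSurjection (id : Fin n → Fin n) :=
  ⟨_root_.id, strictMono_id, fun _ => rfl, fun _ => le_rfl⟩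

theorem IsOrderedSurjection.comp {l m n : ℕ} {s : Fin m → Fin n} {s' : Fin l → Fin m}
    (hs : IsOrderedSurjection s) (hs' : IsOrderedSurjection s') :
    IsOrderedSurjection (s ∘ s') := by
  obtain ⟨g, hg, hsg, hgs⟩ := hs
  obtain ⟨g', hg', hsg', hgs'⟩ := hs'
  exact ⟨g' ∘ g, hg'.comp hg, fun j => by simp [hsg, hsg'],
    fun p => (hg'.monotone (hgs _)).trans (hgs' p)⟩

/-- If the words first differ at `i`, their pullbacks first differ at the minimum of the fibre over
`i`, because fibre minima increase. -/
theorem IsOrderedSurjection.lex_lt {A : Type*} [LinearOrder A] {m n : ℕ} {s : Fin m → Fin n}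
    (hs : IsOrderedSurjection s) {v w : Fin n → A} (h : toLex v < toLex w) :
    toLex (v ∘ s) < toLex (w ∘ s) := by
  obtain ⟨g, hg, hsg, hgs⟩ := hs
  obtain ⟨i, hi, hlt⟩ := h
  refine ⟨g i, fun p hp => hi (s p) (hg.lt_iff_lt.1 ((hgs p).trans_lt hp)), ?_⟩
  simpa [hsg] using hlt

open Classical in
/-- The letters of a word, together with the information whether they occur for the first time. -/
noncomputable def flaggedWord {A : Type*} (w : Σ n, Fin n → A) : List (A × Bool) :=
  List.ofFn fun i => (w.2 i, decide (∀ j < i, w.2 j ≠ w.2 i))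

/-- The embedding provides the fibre minima. A position outside its image is sent to the first
occurrence of its letter in `v`, which exists as the ranges agree. -/
theorem exists_isOrderedSurjection_of_sublist {A : Type*} {v w : Σ n, Fin n → A}
    (hr : Set.range v.2 = Set.range w.2) (h : (flaggedWord v).Sublist (flaggedWord w)) :
    ∃ s : Fin w.1 → Fin v.1, IsOrderedSurjection s ∧ v.2 ∘ s = w.2 := by
  obtain ⟨n, v⟩ := v
  obtain ⟨m, w⟩ := w
  dsimp only at *
  obtain ⟨f, hf⟩ := List.sublist_iff_exists_fin_orderEmbedding_get_eq.1 h
  have hn : (flaggedWord ⟨n, v⟩).length = n := by simp [flaggedWord]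
  have hm : (flaggedWord ⟨m, w⟩).length = m := by simp [flaggedWord]
  let g : Fin n → Fin m := fun i => Fin.cast hm (f (Fin.cast hn.symm i))
  have hg : StrictMono g := fun i j hij => f.strictMono (by simpa using hij)
  have hgw : ∀ i, v i = w (g i) ∧ ((∀ j < i, v j ≠ v i) ↔ ∀ j < g i, w j ≠ w (g i)) := by
    intro i
    have := hf (Fin.cast hn.symm i)
    simp only [flaggedWord, List.get_ofFn, Prod.mk.injEq, decide_eq_decide] at this
    exact this
  have hs : ∀ p, ∃ j, v j = w p ∧ g j ≤ p ∧ ∀ i, g i = p → j = i := by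
    intro p
    by_cases hp : ∃ i, g i = p
    · obtain ⟨i, rfl⟩ := hp
      exact ⟨i, (hgw i).1, le_rfl, fun j hj => (hg.injective hj).symm⟩
    · have hex : ∃ j, v j = w p := by
        have : w p ∈ Set.range v := hr ▸ Set.mem_range_self p
        exact this
      obtain ⟨j, hj, hmin⟩ := WellFounded.has_min (wellFounded_lt (α := Fin n))
        {j | v j = w p} hex
      refine ⟨j, hj, ?_, fun i hi => (hp ⟨i, hi⟩).elim⟩
      by_contra! hlt
      -- The flag makes `g j` the first occurrence of its letter in `w`, so `p` cannot precede it.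
      refine (hgw j).2.1 (fun i hi h => hmin i (h.trans hj) hi) p hlt ?_
      rw [← (hgw j).1, hj]
  choose s hs using hs
  exact ⟨s, ⟨g, hg, fun j => (hs (g j)).2.2 j rfl, fun p => (hs p).2.1⟩,
    funext fun p => (hs p).1⟩

theorem wellQuasiOrdered_words (A : Type*) [Finite A] :
    WellQuasiOrdered fun v w : Σ n, Fin n → A =>
      ∃ s : Fin w.1 → Fin v.1, IsOrderedSurjection s ∧ v.2 ∘ s = w.2 := by
  have higman : WellQuasiOrdered
      (List.SublistForall₂ (Eq : A × Bool → A × Bool → Prop)) := by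
    rw [← Set.partiallyWellOrderedOn_univ_iff]
    have := Set.PartiallyWellOrderedOn.partiallyWellOrderedOn_sublistForall₂
      (Eq : A × Bool → A × Bool → Prop) (s := Set.univ) (Set.finite_univ.partiallyWellOrderedOn)
    simpa using this
  have : IsPreorder (Set A) Eq := { }
  intro f
  obtain ⟨a, b, hab, h₁, h₂⟩ := (Finite.wellQuasiOrdered (Eq : Set A → Set A → Prop)).prod higman
    fun i => (Set.range (f i).2, flaggedWord (f i))
  refine ⟨a, b, hab, exists_isOrderedSurjection_of_sublist h₁ ?_⟩
  obtain ⟨l, hl, hsub⟩ := List.sublistForall₂_iff.1 h₂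
  rw [List.forall₂_eq_eq_eq] at hl
  exact (show flaggedWord (f a) = l from hl) ▸ hsub

/-- Words in the alphabet `A` with a colour from `ι`, ordered lexicographically. -/
abbrev ColouredWord (ι A : Type*) (n : ℕ) : Type _ :=
  ι ×ₗ Lex (Fin n → A)

/-- Pulling back a coloured word along a map of positions. -/
def ColouredWord.pullback {ι A : Type*} {m n : ℕ} (s : Fin m → Fin n) (t : ColouredWord ι A n) :
    ColouredWord ι A m :=
  toLex ((ofLex t).1, toLex (ofLex (ofLex t).2 ∘ s))

theorem ColouredWord.pullback_strictMono {ι A : Type*} [LinearOrder ι] [LinearOrder A] {m n : ℕ}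
    {s : Fin m → Fin n} (hs : IsOrderedSurjection s) :
    StrictMono (pullback s : ColouredWord ι A n → ColouredWord ι A m) := by
  intro t u h
  rw [Prod.Lex.lt_iff] at h ⊢
  exact h.imp_right fun h => ⟨h.1, hs.lex_lt h.2⟩

/-- The maps between sets of coloured words induced by ordered surjections. -/
def ColouredWord.IsOp (ι A : Type*) (n m : ℕ) (f : ColouredWord ι A n → ColouredWord ι A m) :
    Prop :=
  ∃ s : Fin m → Fin n, IsOrderedSurjection s ∧ f = pullback s

instance ColouredWord.isPreorder (ι A : Type*) :
    IsPreorder (Σ n, ColouredWord ι A n) fun a b => ∃ f, IsOp ι A a.1 b.1 f ∧ f a.2 = b.2 where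
  refl a := ⟨_, ⟨_, .id _, rfl⟩, rfl⟩
  trans := by
    rintro a b c ⟨_, ⟨s, hs, rfl⟩, h⟩ ⟨_, ⟨s', hs', rfl⟩, h'⟩
    exact ⟨_, ⟨_, hs.comp hs', rfl⟩, by rw [← h', ← h]; rfl⟩

theorem ColouredWord.wellQuasiOrdered (ι A : Type*) [Finite ι] [Finite A] :
    WellQuasiOrdered fun a b : Σ n, ColouredWord ι A n =>
      ∃ f, IsOp ι A a.1 b.1 f ∧ f a.2 = b.2 := by
  have : IsPreorder ι Eq := { }
  intro f
  obtain ⟨a, b, hab, h₁, s, hs, h₂⟩ := (Finite.wellQuasiOrdered (Eq : ι → ι → Prop)).prod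
    (wellQuasiOrdered_words A) fun i => ((ofLex (f i).2).1, ⟨(f i).1, ofLex (ofLex (f i).2).2⟩)
  exact ⟨a, b, hab, _, ⟨s, hs, rfl⟩, congrArg toLex (Prod.ext h₁ (congrArg toLex h₂))⟩

theorem ColouredWord.exists_finset_generating {k : Type*} [Ring k] [IsNoetherianRing k]
    (ι A : Type*) [LinearOrder ι] [LinearOrder A] [Finite ι] [Finite A]
    (K : ∀ n, Submodule k (ColouredWord ι A n →₀ k))
    (hK : ∀ {m n} (s : Fin m → Fin n), IsOrderedSurjection s → ∀ x ∈ K n,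
      x.mapDomain (pullback s) ∈ K m) :
    ∃ S : Finset (Σ n, K n), ∀ K' : ∀ n, Submodule k (ColouredWord ι A n →₀ k),
      (∀ {m n} (s : Fin m → Fin n), IsOrderedSurjection s → ∀ x ∈ K' n,
        x.mapDomain (pullback s) ∈ K' m) →
      (∀ s ∈ S, (s.2 : ColouredWord ι A s.1 →₀ k) ∈ K' s.1) → ∀ n, K n ≤ K' n := by
  have (n : ℕ) : Finite (ColouredWord ι A n) := inferInstanceAs (Finite (ι × (Fin n → A)))
  obtain ⟨S, hS⟩ := _root_.exists_finset_generating (ColouredWord ι A) (IsOp ι A)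
    (by rintro n m _ ⟨s, hs, rfl⟩; exact pullback_strictMono hs) (wellQuasiOrdered ι A) K
    (by rintro n m _ ⟨s, hs, rfl⟩; exact hK s hs)
  exact ⟨S, fun K' hK' => hS K' (by rintro n m _ ⟨s, hs, rfl⟩; exact hK' s hs)⟩

end Words

/-! ### The category of free modules -/

namespace VCat

variable {R : Type u} [CommRing R]

/-- A finite-rank free module, as an object of `VCat R`. -/
def of (V : Type u) [AddCommGroup V] [Module R V] [Module.Free R V] [Module.Finite R V] :
    VCat R :=
  ⟨⟨ModuleCat.of R V, inferInstanceAs (Module.Free R V), inferInstanceAs (Module.Finite R V)⟩⟩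

/-- The module underlying an object of `VCat R`. -/
abbrev carrier (X : VCat R) : Type u := X.obj.obj

instance (X : VCat R) : Module.Free R X.carrier := X.obj.property.1

instance (X : VCat R) : Module.Finite R X.carrier := X.obj.property.2

theorem splittable_of_surjective {X Y : (finiteFree R).FullSubcategory} (f : X ⟶ Y)
    (hf : Function.Surjective f.hom.hom) : splittable R f := by
  have : Subsingleton (Y.obj ⧸ LinearMap.range (f.hom.hom : X.obj →ₗ[R] Y.obj)) :=
    Submodule.Quotient.subsingleton_iff.2 (LinearMap.range_eq_top.2 hf)
  exact Module.Free.of_subsingleton R _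

/-- Every linear map is the composite of the inclusion of its graph and a projection, both of
which are splittable. -/
theorem multiplicativeClosure_splittable {X Y : (finiteFree R).FullSubcategory} (f : X ⟶ Y) :
    (splittable R).multiplicativeClosure f := by
  have := X.property.1
  have := X.property.2
  have := Y.property.1
  have := Y.property.2
  let φ : X.obj →ₗ[R] Y.obj := f.hom.hom
  let P : (finiteFree R).FullSubcategory := (of (R := R) (X.obj × Y.obj)).obj
  let i : X ⟶ P := ObjectProperty.homMk (ModuleCat.ofHom (LinearMap.id.prod φ))
  let p : P ⟶ Y := ObjectProperty.homMk (ModuleCat.ofHom (LinearMap.snd R X.obj Y.obj))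
  have hip : f = i ≫ p := rfl
  rw [hip]
  refine .comp_of _ _ (.of _ ?_) (splittable_of_surjective p fun y => ⟨(0, y), rfl⟩)
  -- The cokernel of the graph inclusion is identified with the target by (x, y) ↦ y - φ x.
  let q : X.obj × Y.obj →ₗ[R] Y.obj := LinearMap.snd R _ _ - φ ∘ₗ LinearMap.fst R _ _
  have hq : LinearMap.ker q = LinearMap.range (LinearMap.id.prod φ) := by
    ext ⟨x, y⟩
    simp [q, sub_eq_zero, eq_comm (a := φ x)]
  have hsurj : Function.Surjective q := fun y => ⟨(0, y), by simp [q]⟩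
  exact Module.Free.of_equiv
    ((Submodule.quotEquivOfEq _ _ hq.symm).trans (q.quotKerEquivOfSurjective hsurj)).symm

/-- A linear map, as a morphism of `VCat R`. -/
def ofHom {X Y : VCat R} (f : X.carrier →ₗ[R] Y.carrier) : X ⟶ Y :=
  ⟨ObjectProperty.homMk (ModuleCat.ofHom f), multiplicativeClosure_splittable _⟩

theorem ofHom_comp {X Y Z : VCat R} (f : X.carrier →ₗ[R] Y.carrier)
    (g : Y.carrier →ₗ[R] Z.carrier) : ofHom f ≫ ofHom g = ofHom (g ∘ₗ f) := rfl

theorem ofHom_id (X : VCat R) : ofHom (LinearMap.id : X.carrier →ₗ[R] X.carrier) = 𝟙 X := rfl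

theorem ofHom_surjective {X Y : VCat R} (f : X ⟶ Y) : ∃ φ, ofHom φ = f :=
  ⟨f.hom.hom.hom, rfl⟩

variable (R) in
/-- The free module of rank `n`, as an object of `VCat R`. -/
def pow (n : ℕ) : VCat R := of (Fin n → R)

/-- A linear equivalence, as an isomorphism of `VCat R`. -/
def isoOfEquiv {X Y : VCat R} (e : X.carrier ≃ₗ[R] Y.carrier) : X ≅ Y where
  hom := ofHom e.toLinearMap
  inv := ofHom e.symm.toLinearMap
  hom_inv_id := by
    rw [ofHom_comp, ← ofHom_id]
    exact congrArg ofHom e.symm_comp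
  inv_hom_id := by
    rw [ofHom_comp, ← ofHom_id]
    exact congrArg ofHom e.comp_symm

theorem exists_iso_pow (X : VCat R) : ∃ n, Nonempty (X ≅ pow R n) := by
  obtain ⟨n, ⟨b⟩⟩ : ∃ n, Nonempty (Module.Basis (Fin n) R X.carrier) :=
    ⟨_, ⟨(Module.Free.chooseBasis R X.carrier).reindex (Fintype.equivFin _)⟩⟩
  exact ⟨n, ⟨isoOfEquiv (Y := pow R n) b.equivFun⟩⟩

/-- The linear map whose matrix has as its rows the letters of a word. -/
def rows {d n : ℕ} (w : Fin n → Fin d → R) : pow R d ⟶ pow R n :=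
  ofHom (Matrix.mulVecLin (Matrix.of w))

theorem rows_surjective {d n : ℕ} (f : pow R d ⟶ pow R n) : ∃ w, rows w = f := by
  obtain ⟨φ, rfl⟩ := ofHom_surjective f
  refine ⟨Matrix.of.symm (LinearMap.toMatrix' φ), congrArg ofHom ?_⟩
  exact Matrix.toLin'_toMatrix' φ

/-- The linear map between free modules induced by a map of index sets. -/
def reindex {m n : ℕ} (s : Fin m → Fin n) : pow R n ⟶ pow R m :=
  ofHom (LinearMap.funLeft R R s)

theorem rows_reindex {d m n : ℕ} (w : Fin n → Fin d → R) (s : Fin m → Fin n) :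
    rows w ≫ reindex s = rows (w ∘ s) := rfl

/-- Finitely many objects are retracts of a common free module. -/
theorem exists_retracts {r : ℕ} (X : Fin r → VCat R) :
    ∃ d, ∀ i, ∃ (a : X i ⟶ pow R d) (b : pow R d ⟶ X i), a ≫ b = 𝟙 _ := by
  obtain ⟨d, ⟨e⟩⟩ := exists_iso_pow (of (R := R) (∀ i, (X i).carrier))
  refine ⟨d, fun i => ⟨ofHom (Y := of (R := R) (∀ i, (X i).carrier)) 
    (LinearMap.single R (fun i => (X i).carrier) i) ≫ e.hom, e.inv ≫ ofHom (X := of (R := R) (∀ i, (X i).carrier)) (LinearMap.proj i), ?_⟩⟩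
  rw [Category.assoc, e.hom_inv_id_assoc]
  exact congrArg (ofHom (X := X i) (Y := X i)) (LinearMap.proj_comp_single_same R _ i)

end VCat

/-! ### Finite generation -/

namespace CatMod

variable {k : Type w} [Ring k]

section

variable {C : Type u₁} [Category.{v₁} C]

/-- The submodule spanned by the images of given elements of `M X`. -/
def spanSub (M : C ⥤ ModuleCat.{w'} k) {X : C} {ι : Type*} (x : ι → M.obj X) : Sub M where
  obj Y := Submodule.span k (Set.range fun p : ι × (X ⟶ Y) => (M.map p.2).hom (x p.1))
  map {Y Z} f := by
    rw [Submodule.span_le]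
    rintro _ ⟨⟨i, g⟩, rfl⟩
    refine Submodule.subset_span ⟨(i, g ≫ f), ?_⟩
    simp

end

variable {R : Type u} [CommRing R]

/-- Generators can be moved into one M(R^d) along sections, since the retractions recover them. -/
theorem FinitelyGenerated.exists_pow {M : VCat R ⥤ ModuleCat.{w'} k} (h : FinitelyGenerated M) :
    ∃ (r d : ℕ) (x : Fin r → M.obj (VCat.pow R d)), ∀ Y, (spanSub M x).obj Y = ⊤ := by
  obtain ⟨r, X, x, hx⟩ := h
  obtain ⟨d, hd⟩ := VCat.exists_retracts X
  choose a b hab using hd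
  refine ⟨r, d, fun i => (M.map (a i)).hom (x i), hx _ fun i => Submodule.subset_span ⟨(i, b i), ?_⟩⟩
  change (M.map (b i)).hom ((M.map (a i)).hom (x i)) = x i
  rw [← LinearMap.comp_apply, ← ModuleCat.hom_comp, ← M.map_comp, hab, M.map_id]
  rfl

variable (M : VCat R ⥤ ModuleCat.{w'} k) {A ι : Type*} {d : ℕ} (e : A ≃ (Fin d → R))
  (x : ι → M.obj (VCat.pow R d))

/-- The linear combinations of the images of given elements under linear maps, which are encoded
as words. -/
noncomputable def evalWords (n : ℕ) : (ColouredWord ι A n →₀ k) →ₗ[k] M.obj (VCat.pow R n) :=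
  Finsupp.linearCombination k fun t =>
    (M.map (VCat.rows (e ∘ ofLex (ofLex t).2))).hom (x (ofLex t).1)

theorem evalWords_surjective (hx : ∀ Y, (spanSub M x).obj Y = ⊤) (n : ℕ) :
    Function.Surjective (evalWords M e x n) := by
  rw [← LinearMap.range_eq_top, eq_top_iff, ← hx, evalWords, Finsupp.range_linearCombination]
  refine Submodule.span_mono ?_
  rintro _ ⟨⟨i, f⟩, rfl⟩
  obtain ⟨w, rfl⟩ := VCat.rows_surjective f
  refine ⟨toLex (i, toLex (e.symm ∘ w)), ?_⟩
  simp [← Function.comp_assoc]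

theorem evalWords_mapDomain {m n : ℕ} (s : Fin m → Fin n) (y : ColouredWord ι A n →₀ k) :
    evalWords M e x m (y.mapDomain (ColouredWord.pullback s)) =
      (M.map (VCat.reindex s)).hom (evalWords M e x n y) := by
  rw [evalWords, evalWords, Finsupp.linearCombination_mapDomain, Finsupp.apply_linearCombination]
  congr 2
  funext t
  change (M.map (VCat.rows ((e ∘ ofLex (ofLex t).2) ∘ s))).hom _ = _
  rw [← VCat.rows_reindex, M.map_comp]
  rfl

theorem finitelyGenerated_of_evalWords_surjective [IsNoetherianRing k] [Finite ι] [Finite A]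
    [LinearOrder ι] [LinearOrder A] (hsurj : ∀ n, Function.Surjective (evalWords M e x n))
    (N : Sub M) : FinitelyGenerated N.toFunctor := by
  obtain ⟨S, hS⟩ := ColouredWord.exists_finset_generating ι A
    (fun n => (N.obj (VCat.pow R n)).comap (evalWords M e x n)) fun s _ y hy => by
      rw [Submodule.mem_comap, evalWords_mapDomain]
      exact N.map _ hy
  refine ⟨S.card, fun i => VCat.pow R (S.equivFin.symm i).1.1,
    fun i => ⟨evalWords M e x _ (S.equivFin.symm i).1.2, (S.equivFin.symm i).1.2.2⟩,
    fun N' hN' Y => ?_⟩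
  -- The test family consists of the preimages of `N'`, viewed inside `M`.
  have hpow := hS
    (fun n => ((N'.obj (VCat.pow R n)).map (N.obj (VCat.pow R n)).subtype).comap
      (evalWords M e x n))
    (fun s _ y hy => by
      obtain ⟨z, hz, hzy⟩ := hy
      rw [Submodule.mem_comap, evalWords_mapDomain, ← hzy]
      exact ⟨_, N'.map (VCat.reindex s) hz, rfl⟩)
    (fun s hs => by
      obtain ⟨i, hi⟩ := S.equivFin.symm.surjective ⟨s, hs⟩
      obtain rfl : (S.equivFin.symm i).1 = s := congrArg Subtype.val hi
      exact ⟨_, hN' i, rfl⟩)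
  obtain ⟨n, ⟨i⟩⟩ := VCat.exists_iso_pow Y
  rw [eq_top_iff]
  intro z _
  obtain ⟨y, hy⟩ := hsurj n ((N.toFunctor.map i.hom).hom z : N.obj (VCat.pow R n)).1
  obtain ⟨z', hz', hzz'⟩ := hpow n (show y ∈ Submodule.comap _ _ by
    rw [Submodule.mem_comap, hy]; exact Subtype.property _)
  have hz'' : z' = (N.toFunctor.map i.hom).hom z := Subtype.ext (hzz'.trans hy)
  have := N'.map i.inv hz'
  rw [hz'', Submodule.mem_comap, ← LinearMap.comp_apply, ← ModuleCat.hom_comp,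
    ← Functor.map_comp, i.hom_inv_id, CategoryTheory.Functor.map_id] at this
  exact this

end CatMod

theorem theoremB (R : Type u) [CommRing R] [Finite R] :
    CatMod.Noetherian.{w, w'} (VCat R) := by
  intro k _ _ M hM N
  obtain ⟨r, d, x, hx⟩ := hM.exists_pow
  exact CatMod.finitelyGenerated_of_evalWords_surjective M (Finite.equivFin (Fin d → R)).symm x
    (CatMod.evalWords_surjective M _ x hx) N
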